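/- **Model.** Let $0<p<1$, $0<p_r<1$, $q=1-p$. A street of level $l\ge 0$ is a segment $\{b2^{-(l+1)}\}\times[0,1]$ or $[0,1]\times\{b2^{-(l+1)}\}$ with $b$ odd, $1\le b\le 2^{l+1}-1$; the central cross is the union of the two streets of level $0$. For each $n$, place $n$ independent mobile users, each distributed with one-dimensional density $\frac p2\left(\frac q2\right)^l$ on every street of level $l$. Independently of the users, and independently over all crossings, put at the crossing of a vertical street of level $h$ with a horizontal street of level $v$ a Poisson number of auxiliary points with mean $n\,p_r^2\left(\frac{1-p_r}2\right)^{h+v}$; a relay stands at the crossing if this number is at least one. The nodes are the $n$ users and the relays. The fractal dimensions are $$d_F=\frac{\log(4/q)}{\log 2},\qquad d_r=\frac{2\log(2/(1-p_r))}{\log 2}.$$ A hop joins two distinct nodes of a common street that have no mobile user strictly between them. On a street with $m$ mobile users it takes the power $P_{\max}/\max(m,1)^{\delta}$, where $P_{\max}>0$ and $\delta\ge 2$. The maximum power of a path is the largest power of its hops, and its length is its number of hops. Let $G'_1(n,M)$ be the set of nodes that are connected to a node of the central cross by a path of maximum power at most $M$ going through at most one relay. **Theorem.** Assume $d_F>3$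 and $d_r<d_F-1$. There is a constant $C>0$, depending only on $p$ and $p_r$, such that for $M_n=P_{\max}$, for all $P_{\max}>0$ and $\delta\ge 2$, with probability tending to $1$ as $n\to\infty$, any two nodes of $G'_1(n,M_n)$ are joined by a path of maximum power at most $M_n$, and the shortest such path has at most $$C\,n^{\,1-\frac{2}{d_r(1+1/d_F)}}$$ hops. -/

import Mathlib

open MeasureTheory Filter Topology

namespace Hyperfractal

/-- The dyadic lines of one direction: `⟨l, j⟩` is the line of level `l` and offset
`b 2^{-(l+1)}` with `b = 2 j + 1` odd, `1 ≤ b ≤ 2^{l+1} - 1`. -/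
abbrev Line : Type := Σ l : ℕ, Fin (2 ^ l)

noncomputable def Line.offset (a : Line) : ℝ := (2 * (a.2 : ℕ) + 1 : ℝ) / 2 ^ (a.1 + 1)

/-- The streets of the map, that is the segments of length one that constitute the support. -/
structure Street where
  vertical : Bool
  line : Line

def Street.level (s : Street) : ℕ := s.line.1

/-- The point of the street `s` at abscissa `t ∈ [0,1]` along the street. -/
noncomputable def Street.point (s : Street) (t : ℝ) : ℝ × ℝ :=
  if s.vertical then (s.line.offset, t) else (t, s.line.offset)

def Street.carrier (s : Street) : Set (ℝ × ℝ) := s.point '' Set.Icc 0 1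

/-- The subset of the unit square covered by the streets of level `l`;
`support 0` is the central cross. -/
def support (l : ℕ) : Set (ℝ × ℝ) := ⋃ (s : Street) (_ : s.level = l), s.carrier

/-- The law of one mobile user: its one-dimensional density is `(p/2) (q/2)^l`, `q = 1 - p`,
with respect to length on every street of level `l`. -/
noncomputable def mobileLaw (p : ℝ) : Measure (ℝ × ℝ) :=
  Measure.sum fun s : Street =>
    ENNReal.ofReal (p / 2 * ((1 - p) / 2) ^ s.level) •
      Measure.map s.point (volume.restrict (Set.Icc (0 : ℝ) 1))

/-- A crossing: a vertical line (first component) and a horizontal line (second component). -/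
abbrev Crossing : Type := Line × Line

noncomputable def Crossing.point (c : Crossing) : ℝ × ℝ := (c.1.offset, c.2.offset)

/-- The mean number of points of the auxiliary Poisson process at a crossing. -/
noncomputable def relayIntensity (ρ pr : ℝ) (c : Crossing) : NNReal :=
  (ρ * pr ^ 2 * ((1 - pr) / 2) ^ (c.1.1 + c.2.1)).toNNReal

/-- A realization of the map: the positions of the `n` mobile users, and the number of points of
the auxiliary Poisson process at each crossing. -/
abbrev Config (n : ℕ) : Type := (Fin n → ℝ × ℝ) × (Crossing → ℕ)

/-- The law of the hyperfractal map with `n` mobile users and relay parameter `ρ = n`: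
independent mobile users, and independent Poisson numbers at the crossings. -/
noncomputable def mapLaw (p pr : ℝ) (n : ℕ) : Measure (Config n) :=
  (Measure.pi fun _ : Fin n => mobileLaw p).prod
    (Measure.infinitePi fun c : Crossing =>
      ProbabilityTheory.poissonMeasure (relayIntensity n pr c))

/-- The fractal dimension of the mobile users. -/
noncomputable def dimF (p : ℝ) : ℝ := Real.log (4 / (1 - p)) / Real.log 2

/-- The fractal dimension of the relays. -/
noncomputable def dimR (pr : ℝ) : ℝ := 2 * (Real.log (2 / (1 - pr)) / Real.log 2)

/-- Potential nodes of the network: mobile users, and relays at crossings. -/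
abbrev Node (n : ℕ) : Type := Fin n ⊕ Crossing

/-- Mobile users are always present; a relay stands at a crossing exactly when the auxiliary
Poisson process has at least one point there. -/
def Present {n : ℕ} (ω : Config n) : Node n → Prop
  | Sum.inl _ => True
  | Sum.inr c => ω.2 c ≠ 0

noncomputable def position {n : ℕ} (ω : Config n) : Node n → ℝ × ℝ
  | Sum.inl i => ω.1 i
  | Sum.inr c => c.point

/-- The number of mobile users on a street. -/
noncomputable def userCount {n : ℕ} (ω : Config n) (s : Street) : ℕ :=
  {i : Fin n | ω.1 i ∈ s.carrier}.ncard

/-- The nominal power `P_max / m^δ` of transmissions on a street with `m` mobile users.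
On a street without users it is `P_max`, the power that reaches from end to end. -/
noncomputable def streetPower {n : ℕ} (δ Pmax : ℝ) (ω : Config n) (s : Street) : ℝ :=
  Pmax / (max (userCount ω s) 1 : ℝ) ^ δ

/-- `u` and `v` are nodes of the street `s` with no mobile user strictly between them. -/
def NeighborsOn {n : ℕ} (ω : Config n) (s : Street) (u v : Node n) : Prop :=
  Present ω u ∧ Present ω v ∧ position ω u ∈ s.carrier ∧ position ω v ∈ s.carrier ∧
    ∀ i : Fin n, ¬ Sbtw ℝ (position ω u) (ω.1 i) (position ω v)

/-- The graph of the hops between next neighbors on a street that need a power of at most `M`.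
Its walks are the routing paths of maximum power at most `M`, and the length of a walk is its
number of hops. A relay uses on each of its two streets the nominal power of that street. -/
def hopGraph {n : ℕ} (δ Pmax : ℝ) (ω : Config n) (M : ℝ) : SimpleGraph (Node n) where
  Adj u v := u ≠ v ∧ ∃ s : Street, NeighborsOn ω s u v ∧ streetPower δ Pmax ω s ≤ M
  symm := ⟨by
    rintro u v ⟨hne, s, ⟨hu, hv, hus, hvs, hb⟩, hM⟩
    exact ⟨hne.symm, s, ⟨hv, hu, hvs, hus, fun i hi => hb i hi.symm⟩, hM⟩⟩
  loopless := ⟨fun _ h => h.1 rfl⟩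

/-- `G'_k(n, M)`: the nodes connected to the central cross by a path of maximum power at most `M`
that goes through at most `k` relays. -/
def giant {n : ℕ} (δ Pmax : ℝ) (ω : Config n) (k : ℕ) (M : ℝ) : Set (Node n) :=
  {u | Present ω u ∧ ∃ v : Node n, Present ω v ∧ position ω v ∈ support 0 ∧
    ∃ W : (hopGraph δ Pmax ω M).Walk u v, W.support.countP (fun x => x.isRight) ≤ k}

end Hyperfractal

namespace Hyperfractal

/-! ### Geometry of the streets -/

/-! Every street has nominal power at most `Pmax`, so at `M = Pmax` the power constraint is void and
only hops have to be counted. A hop count along part of a street is one plus the number of users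
passed (`withinHops_of_Ioo`), so the task is to route through short or sparse pieces of street,
turning only where relays exist.

Write `D = dimF p`, `R = dimR pr`, `a = 2 / (R (1 + 1/D))`, `x = n^(-a)`. A piece of street of mass
at most `x` holds about `n x = n^(1-a)` users or fewer, which is the target bound. A crossing of
level sum `k` carries a relay with high probability when `n 2^(-R k / 2)` is large, that is for `k`
below `(2/R) log₂ n = a (1 + 1/D) log₂ n` by a fixed factor.

In units of `a log₂ n`, take `J = 1/(D-1)`, `H = 1` and `A = (D-2)/(D-1)^2`. A whole street of level
at least `J`, an interval of length `2^(-J)` on a street of level at least `A`, and an interval of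
length `2^(-H)` on any street all have mass at most `x`. From a street of level between `A` and `J`,
a user turns at a nearby line of level `J`, then follows whole streets of level `J` to a fixed hub.
From a street of level below `A`, the user first takes a nearby street of level `H` up to a street
of level `A`. The crossings used have level sum at most `max (A + H) (2 J)`, and `ladder_lt` puts
this below `1 + 1/D`.

A node of the giant set is on the cross or one street away from it, so a bounded number of such
pieces joins it to the hub (`withinHops_hub_of_mem_giant`). The probability estimate is
`mapLaw_not_goodConfig_le`. -/

theorem Line.offset_mem (a : Line) : a.offset ∈ Set.Icc (0 : ℝ) 1 := by
  have h : ((a.2 : ℕ) : ℝ) + 1 ≤ 2 ^ a.1 := by exact_mod_cast a.2.2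
  refine ⟨by unfold Line.offset; positivity, ?_⟩
  unfold Line.offset
  rw [div_le_one (by positivity), pow_succ]
  linarith

/-- An odd numerator over a power of two is a reduced fraction: distinct levels would make an odd
number equal to an even one. -/
theorem Line.offset_injective : Function.Injective Line.offset := by
  have key : ∀ a b : Line, a.offset = b.offset → a.1 ≤ b.1 := by
    intro a b h
    by_contra! hlt
    obtain ⟨d, hd⟩ := Nat.exists_eq_add_of_lt hlt
    unfold Line.offset at h
    have hpow : (2 : ℝ) ^ (a.1 + 1) = 2 ^ (b.1 + 1) * 2 ^ (d + 1) := by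
      rw [hd]; ring
    rw [div_eq_div_iff (by positivity) (by positivity), hpow] at h
    have h2 : (2 * (a.2 : ℕ) + 1 : ℝ) = (2 * (b.2 : ℕ) + 1 : ℝ) * 2 ^ (d + 1) := by
      have : (2 : ℝ) ^ (b.1 + 1) ≠ 0 := by positivity
      apply mul_right_cancel₀ this
      rw [h, mul_comm ((2 : ℝ) ^ (b.1 + 1)), mul_assoc]
    have h3 : 2 * (a.2 : ℕ) + 1 = (2 * (b.2 : ℕ) + 1) * 2 ^ (d + 1) := by exact_mod_cast h2
    rw [pow_succ, ← mul_assoc] at h3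
    omega
  intro a b h
  have hl : a.1 = b.1 := le_antisymm (key a b h) (key b a h.symm)
  obtain ⟨l, i⟩ := a
  obtain ⟨l', j⟩ := b
  obtain rfl : l = l' := hl
  unfold Line.offset at h
  rw [div_left_inj' (by positivity)] at h
  have : (i : ℕ) = j := by
    have h' : ((i : ℕ) : ℝ) = ((j : ℕ) : ℝ) := by linarith
    exact_mod_cast h'
  rw [Fin.ext this]

theorem Street.point_injective (s : Street) : Function.Injective s.point := by
  intro t t' h
  unfold Street.point at h
  split_ifs at h <;> simpa using h

theorem Street.point_mem_carrier (s : Street) {t : ℝ} : s.point t ∈ s.carrier ↔ t ∈ Set.Icc 0 1 :=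
  s.point_injective.mem_set_image

theorem Street.exists_of_sbtw (s : Street) {t₁ t₂ : ℝ} (h : t₁ ≤ t₂) {z : ℝ × ℝ}
    (hz : Sbtw ℝ (s.point t₁) z (s.point t₂)) : ∃ t ∈ Set.Ioo t₁ t₂, s.point t = z := by
  obtain ⟨⟨c, hc, rfl⟩, h1, h2⟩ := hz
  have he : s.point (t₁ + c * (t₂ - t₁)) = AffineMap.lineMap (s.point t₁) (s.point t₂) c := by
    unfold Street.point
    split_ifs <;> ext <;> simp [AffineMap.lineMap_apply] <;> ring
  refine ⟨_, ⟨lt_of_le_of_ne ?_ fun h => h1 ?_, lt_of_le_of_ne ?_ fun h => h2 ?_⟩, he⟩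
  · nlinarith [mul_nonneg hc.1 (sub_nonneg.2 h)]
  · rw [← he, ← h]
  · nlinarith [mul_le_mul_of_nonneg_right hc.2 (sub_nonneg.2 h)]
  · rw [← he, h]

/-- The street orthogonal to `s` on the line `a`. -/
def Street.perp (s : Street) (a : Line) : Street := ⟨!s.vertical, a⟩

/-- The crossing of the street `s` with the orthogonal street on the line `a`. -/
def Street.crossing (s : Street) (a : Line) : Crossing :=
  if s.vertical then (s.line, a) else (a, s.line)

theorem Street.point_offset (s : Street) (a : Line) : s.point a.offset = (s.crossing a).point := by
  unfold Street.point Street.crossing Crossing.point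
  split_ifs <;> rfl

theorem Street.crossing_perp (s : Street) (a : Line) :
    (s.perp a).crossing s.line = s.crossing a := by
  unfold Street.crossing Street.perp
  cases s.vertical <;> rfl

theorem Street.level_crossing (s : Street) (a : Line) :
    (s.crossing a).1.1 + (s.crossing a).2.1 = s.level + a.1 := by
  unfold Street.crossing Street.level
  split_ifs
  · rfl
  · exact add_comm _ _

theorem Street.crossing_mem (s : Street) (a : Line) : (s.crossing a).point ∈ s.carrier := by
  rw [← s.point_offset, s.point_mem_carrier]
  exact a.offset_mem

theorem Street.crossing_mem_perp (s : Street) (a : Line) :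
    (s.crossing a).point ∈ (s.perp a).carrier := by
  rw [← s.crossing_perp]
  exact Street.crossing_mem _ _

theorem mem_support {l : ℕ} {z : ℝ × ℝ} :
    z ∈ support l ↔ ∃ s : Street, s.level = l ∧ z ∈ s.carrier := by
  simp [support]

/-- The `j`-th dyadic interval of length `2^{-k}`. -/
def dyadic (k j : ℕ) : Set ℝ := Set.Icc ((j : ℝ) / 2 ^ k) ((j + 1 : ℝ) / 2 ^ k)

theorem dyadic_zero : dyadic 0 0 = Set.Icc 0 1 := by
  simp [dyadic]

/-- The lines of level `k` sit at the midpoints of the dyadic intervals of length `2^(-k)`, so a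
traveller reaches one without leaving its interval. -/
theorem exists_offset_mem_dyadic (k : ℕ) {t : ℝ} (ht : t ∈ Set.Icc (0 : ℝ) 1) :
    ∃ j : Fin (2 ^ k), t ∈ dyadic k j ∧ Line.offset ⟨k, j⟩ ∈ dyadic k j := by
  have hpos : (0 : ℝ) < 2 ^ k := by positivity
  have hoff : ∀ j : Fin (2 ^ k), Line.offset ⟨k, j⟩ ∈ dyadic k j := by
    intro j
    have : Line.offset ⟨k, j⟩ = ((j : ℕ) + 1 / 2 : ℝ) / 2 ^ k := by
      simp only [Line.offset, pow_succ]
      field_simp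
    rw [this]
    constructor <;> gcongr <;> norm_num
  rcases eq_or_lt_of_le ht.2 with rfl | h1
  -- At `t = 1` the floor would give the index `2^k`, which is out of range; the last interval is
  -- used instead.
  · refine ⟨⟨2 ^ k - 1, Nat.sub_lt (by positivity) one_pos⟩, ?_, hoff _⟩
    have : ((2 ^ k - 1 : ℕ) : ℝ) = 2 ^ k - 1 := by
      rw [Nat.cast_sub Nat.one_le_two_pow]; simp
    simp only [dyadic, this]
    constructor
    · rw [div_le_one hpos]; linarith
    · rw [one_le_div hpos]; linarith
  · have hlt : ⌊t * 2 ^ k⌋₊ < 2 ^ k := by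
      rw [Nat.floor_lt (by have := ht.1; positivity)]
      push_cast
      nlinarith
    refine ⟨⟨_, hlt⟩, ⟨?_, ?_⟩, hoff _⟩
    · rw [div_le_iff₀ hpos]
      exact Nat.floor_le (by have := ht.1; positivity)
    · rw [le_div_iff₀ hpos]
      exact (Nat.lt_floor_add_one _).le

/-! ### Routing along streets -/

/-- `u` and `v` are joined by a path of at most `k` hops. -/
def WithinHops {V : Type*} (G : SimpleGraph V) (k : ℕ) (u v : V) : Prop :=
  ∃ W : G.Walk u v, W.length ≤ k

theorem WithinHops.trans {V : Type*} {G : SimpleGraph V} {k k' : ℕ} {u v w : V}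
    (h : WithinHops G k u v) (h' : WithinHops G k' v w) : WithinHops G (k + k') u w := by
  obtain ⟨W, hW⟩ := h
  obtain ⟨W', hW'⟩ := h'
  exact ⟨W.append W', by rw [SimpleGraph.Walk.length_append]; omega⟩

theorem WithinHops.symm {V : Type*} {G : SimpleGraph V} {k : ℕ} {u v : V}
    (h : WithinHops G k u v) : WithinHops G k v u := by
  obtain ⟨W, hW⟩ := h
  exact ⟨W.reverse, by rwa [SimpleGraph.Walk.length_reverse]⟩

theorem WithinHops.mono {V : Type*} {G : SimpleGraph V} {k k' : ℕ} {u v : V}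
    (h : WithinHops G k u v) (hk : k ≤ k') : WithinHops G k' u v := by
  obtain ⟨W, hW⟩ := h
  exact ⟨W, hW.trans hk⟩

variable {n : ℕ} {δ Pmax : ℝ} {ω : Config n}

theorem streetPower_le (hδ : 0 ≤ δ) (hP : 0 ≤ Pmax) (ω : Config n) (s : Street) :
    streetPower δ Pmax ω s ≤ Pmax :=
  div_le_self hP (Real.one_le_rpow (le_max_right _ _) hδ)

/-- The users on the part of the street `s` at abscissas in `I`. -/
def usersOn (ω : Config n) (s : Street) (I : Set ℝ) : Set (Fin n) :=
  {i | ω.1 i ∈ s.point '' I}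

/-- Induction on the user bound: with no user strictly between, the ends coincide or form one hop;
otherwise the path is split at any user in between. -/
theorem withinHops_of_Ioo (hδ : 0 ≤ δ) (hP : 0 ≤ Pmax) (s : Street) (k : ℕ) :
    ∀ (u v : Node n) (t₁ t₂ : ℝ), Present ω u → Present ω v → position ω u = s.point t₁ →
      position ω v = s.point t₂ → 0 ≤ t₁ → t₁ ≤ t₂ → t₂ ≤ 1 →
      (usersOn ω s (Set.Ioo t₁ t₂)).ncard ≤ k →
      WithinHops (hopGraph δ Pmax ω Pmax) (k + 1) u v := by
  induction k using Nat.strong_induction_on with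
  | _ k ih =>
    intro u v t₁ t₂ hu hv hut hvt h0 h12 h1 hk
    rcases (usersOn ω s (Set.Ioo t₁ t₂)).eq_empty_or_nonempty with hem | ⟨i, t, ht, hi⟩
    · by_cases huv : u = v
      · subst huv
        exact ⟨SimpleGraph.Walk.nil, by simp⟩
      · have hadj : (hopGraph δ Pmax ω Pmax).Adj u v := by
          refine ⟨huv, s, ⟨hu, hv, ?_, ?_, fun i hi => ?_⟩, streetPower_le hδ hP ω s⟩
          · rw [hut, s.point_mem_carrier]; exact ⟨h0, h12.trans h1⟩
          · rw [hvt, s.point_mem_carrier]; exact ⟨h0.trans h12, h1⟩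
          · rw [hut, hvt] at hi
            obtain ⟨t, ht, hti⟩ := s.exists_of_sbtw h12 hi
            have : i ∈ usersOn ω s (Set.Ioo t₁ t₂) := ⟨t, ht, hti⟩
            simp [hem] at this
        exact ⟨hadj.toWalk, by simp⟩
    · have hd : Disjoint (usersOn ω s (Set.Ioo t₁ t)) (usersOn ω s (Set.Ioo t t₂)) := by
        rw [Set.disjoint_left]
        rintro x ⟨a, ha, hxa⟩ ⟨b, hb, hxb⟩
        have := s.point_injective (hxa.trans hxb.symm)
        exact absurd (this ▸ ha.2) (not_lt.2 hb.1.le)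
      have hni : i ∉ usersOn ω s (Set.Ioo t₁ t) ∪ usersOn ω s (Set.Ioo t t₂) := by
        rintro (⟨a, ha, hxa⟩ | ⟨a, ha, hxa⟩)
        · exact ha.2.ne (s.point_injective (hxa.trans hi.symm))
        · exact ha.1.ne' (s.point_injective (hxa.trans hi.symm))
      have hsub : insert i (usersOn ω s (Set.Ioo t₁ t) ∪ usersOn ω s (Set.Ioo t t₂)) ⊆
          usersOn ω s (Set.Ioo t₁ t₂) := by
        refine Set.insert_subset ⟨t, ht, hi⟩ (Set.union_subset ?_ ?_)
        · exact fun x ⟨a, ha, hxa⟩ => ⟨a, ⟨ha.1, ha.2.trans ht.2⟩, hxa⟩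
        · exact fun x ⟨a, ha, hxa⟩ => ⟨a, ⟨ht.1.trans ha.1, ha.2⟩, hxa⟩
      have hcard := Set.ncard_le_ncard hsub (Set.toFinite _)
      rw [Set.ncard_insert_of_notMem hni (Set.toFinite _),
        Set.ncard_union_eq hd (Set.toFinite _) (Set.toFinite _)] at hcard
      have w1 := ih _ (by omega) u (Sum.inl i) t₁ t hu trivial hut hi.symm h0 ht.1.le
        (ht.2.le.trans h1) le_rfl
      have w2 := ih _ (by omega) (Sum.inl i) v t t₂ trivial hv hi.symm hvt (h0.trans ht.1.le)
        ht.2.le h1 le_rfl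
      exact (w1.trans w2).mono (by omega)

theorem withinHops_of_interval (hδ : 0 ≤ δ) (hP : 0 ≤ Pmax) (s : Street) {a b : ℝ} {m : ℕ}
    (hm : (usersOn ω s (Set.Icc a b)).ncard ≤ m) {u v : Node n} {t₁ t₂ : ℝ}
    (hu : Present ω u) (hv : Present ω v) (hut : position ω u = s.point t₁)
    (hvt : position ω v = s.point t₂) (h₁ : t₁ ∈ Set.Icc a b) (h₂ : t₂ ∈ Set.Icc a b)
    (h₁' : t₁ ∈ Set.Icc (0 : ℝ) 1) (h₂' : t₂ ∈ Set.Icc (0 : ℝ) 1) :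
    WithinHops (hopGraph δ Pmax ω Pmax) (m + 1) u v := by
  have key : ∀ x y, a ≤ x → y ≤ b → (usersOn ω s (Set.Ioo x y)).ncard ≤ m := fun x y hx hy => by
    refine (Set.ncard_le_ncard ?_ (Set.toFinite _)).trans hm
    rintro i ⟨t, ht, hi⟩
    exact ⟨t, ⟨hx.trans ht.1.le, ht.2.le.trans hy⟩, hi⟩
  rcases le_total t₁ t₂ with h | h
  · exact withinHops_of_Ioo hδ hP s m u v t₁ t₂ hu hv hut hvt h₁'.1 h h₂'.2 (key _ _ h₁.1 h₂.2)
  · exact (withinHops_of_Ioo hδ hP s m v u t₂ t₁ hv hu hvt hut h₂'.1 h h₁'.2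
      (key _ _ h₂.1 h₁.2)).symm

/-- Every dyadic interval of length `2^{-k}` on a street of level at least `l` contains at most
`m` users. -/
def SparseUsers (ω : Config n) (l k m : ℕ) : Prop :=
  ∀ s : Street, l ≤ s.level → ∀ j < 2 ^ k, (usersOn ω s (dyadic k j)).ncard ≤ m

theorem SparseUsers.withinHops_street {l m : ℕ} (h : SparseUsers ω l 0 m) (hδ : 0 ≤ δ)
    (hP : 0 ≤ Pmax) {s : Street} (hs : l ≤ s.level) {u v : Node n} (hu : Present ω u)
    (hv : Present ω v) (hus : position ω u ∈ s.carrier) (hvs : position ω v ∈ s.carrier) :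
    WithinHops (hopGraph δ Pmax ω Pmax) (m + 1) u v := by
  obtain ⟨t₁, h₁, e₁⟩ := hus
  obtain ⟨t₂, h₂, e₂⟩ := hvs
  have := h s hs 0 (by simp)
  rw [dyadic_zero] at this
  exact withinHops_of_interval hδ hP s this hu hv e₁.symm e₂.symm h₁ h₂ h₁ h₂

theorem SparseUsers.withinHops_crossing {l k m : ℕ} (h : SparseUsers ω l k m) (hδ : 0 ≤ δ)
    (hP : 0 ≤ Pmax) {s : Street} (hs : l ≤ s.level)
    (hr : ∀ j, Present ω (Sum.inr (s.crossing ⟨k, j⟩))) {u : Node n}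
    (hu : Present ω u) (hus : position ω u ∈ s.carrier) :
    ∃ a : Line, a.1 = k ∧
      WithinHops (hopGraph δ Pmax ω Pmax) (m + 1) u (Sum.inr (s.crossing a)) := by
  obtain ⟨t, ht, e⟩ := hus
  obtain ⟨j, hj, hj'⟩ := exists_offset_mem_dyadic k ht
  exact ⟨⟨k, j⟩, rfl, withinHops_of_interval hδ hP s (h s hs j j.2) hu (hr j) e.symm
    (s.point_offset _).symm hj hj' ht (Line.offset_mem _)⟩

/-! ### The nodes linked to the central cross through one relay -/

/-- A path can change streets only at a relay, because each user lies on a single street. -/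
theorem mem_support_of_walk_users {G : SimpleGraph (Node n)} (hG : G ≤ hopGraph δ Pmax ω Pmax)
    (huniq : ∀ i s s', ω.1 i ∈ Street.carrier s → ω.1 i ∈ Street.carrier s' → s = s')
    {u v : Node n} (W : G.Walk u v) (hv : position ω v ∈ support 0)
    (hW : W.support.countP (fun x => x.isRight) = 0) : position ω u ∈ support 0 := by
  induction W with
  | nil => exact hv
  | @cons u w v h W ih =>
    rw [SimpleGraph.Walk.support_cons, List.countP_cons] at hW
    have hw := ih hv (by omega)
    obtain ⟨-, s, ⟨-, -, hus, hws, -⟩, -⟩ := hG h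
    obtain ⟨s', hs', hws'⟩ := mem_support.1 hw
    rcases w with i | c
    · exact mem_support.2 ⟨s, huniq i s s' hws hws' ▸ hs', hus⟩
    · exfalso
      have : 0 < W.support.countP (fun x => x.isRight) :=
        List.countP_pos_iff.2 ⟨_, W.start_mem_support, rfl⟩
      omega

/-- Off the cross, the single relay is the one where the path turns onto the cross. Recording that
the start is then a user (`isLeft`) makes the induction close: a start that is itself a relay
exhausts the budget and must be on the cross. -/
theorem mem_support_or_exists_relay {G : SimpleGraph (Node n)} (hG : G ≤ hopGraph δ Pmax ω Pmax)
    (huniq : ∀ i s s', ω.1 i ∈ Street.carrier s → ω.1 i ∈ Street.carrier s' → s = s')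
    {u v : Node n} (W : G.Walk u v) (hv : position ω v ∈ support 0)
    (hW : W.support.countP (fun x => x.isRight) ≤ 1) :
    position ω u ∈ support 0 ∨ u.isLeft ∧ ∃ (s : Street) (c : Crossing), position ω u ∈ s.carrier ∧
      c.point ∈ s.carrier ∧ c.point ∈ support 0 ∧ Present ω (Sum.inr c) := by
  induction W with
  | nil => exact Or.inl hv
  | @cons u w v h W ih =>
    rw [SimpleGraph.Walk.support_cons, List.countP_cons] at hW
    obtain ⟨-, s, ⟨-, hwp, hus, hws, -⟩, -⟩ := hG h
    rcases u with i | c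
    · rcases w with i' | c'
      · rcases ih hv (by omega) with h0 | ⟨-, s', c, h1, h2, h3, h4⟩
        · obtain ⟨s', hs', hws'⟩ := mem_support.1 h0
          exact Or.inl (mem_support.2 ⟨s, huniq i' s s' hws hws' ▸ hs', hus⟩)
        · obtain rfl := huniq i' s s' hws h1
          exact Or.inr ⟨rfl, s, c, hus, h2, h3, h4⟩
      · rcases ih hv (by omega) with h0 | ⟨h0, -⟩
        · exact Or.inr ⟨rfl, s, c', hus, hws, h0, hwp⟩
        · simp at h0
    · have h0 : W.support.countP (fun x => x.isRight) = 0 := by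
        simp only [Sum.isRight_inr, if_true] at hW
        omega
      have hw := mem_support_of_walk_users hG huniq W hv h0
      obtain ⟨s', hs', hws'⟩ := mem_support.1 hw
      rcases w with i' | c'
      · exact Or.inl (mem_support.2 ⟨s, huniq i' s s' hws hws' ▸ hs', hus⟩)
      · exfalso
        have : 0 < W.support.countP (fun x => x.isRight) :=
          List.countP_pos_iff.2 ⟨_, W.start_mem_support, rfl⟩
        omega

/-- A configuration in which the routing of the main theorem succeeds: no user is on two streets,
all crossings of level at most `K` carry a relay, and the relevant intervals have at most `m`
users. -/
structure GoodConfig (ω : Config n) (A J H K m : ℕ) : Prop where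
  uniq : ∀ i s s', ω.1 i ∈ Street.carrier s → ω.1 i ∈ Street.carrier s' → s = s'
  relay : ∀ c : Crossing, c.1.1 + c.2.1 ≤ K → ω.2 c ≠ 0
  high : SparseUsers ω J 0 m
  middle : SparseUsers ω A J m
  low : SparseUsers ω 0 H m

namespace GoodConfig

variable {A J H K m : ℕ}

theorem present (h : GoodConfig ω A J H K m) {s : Street} {a : Line} (hK : s.level + a.1 ≤ K) :
    Present ω (Sum.inr (s.crossing a)) :=
  h.relay _ (by rwa [s.level_crossing])

/-- A crossing of level `(J, J)` towards which all traffic is routed. -/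
def hub (J : ℕ) : Crossing := (⟨J, ⟨0, by positivity⟩⟩, ⟨J, ⟨0, by positivity⟩⟩)

theorem withinHops_hub_of_level_eq (h : GoodConfig ω A J H K m) (hδ : 0 ≤ δ) (hP : 0 ≤ Pmax)
    (hJK : J + J ≤ K) {s : Street} (hs : s.level = J) {u : Node n} (hu : Present ω u)
    (hus : position ω u ∈ s.carrier) :
    WithinHops (hopGraph δ Pmax ω Pmax) (2 * (m + 1)) u (Sum.inr (hub J)) := by
  set a : Line := ⟨J, ⟨0, by positivity⟩⟩ with ha
  have hp : Present ω (Sum.inr (s.crossing a)) := h.present (by rw [hs]; exact hJK)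
  have w1 := h.high.withinHops_street hδ hP hs.ge hu hp hus (s.crossing_mem a)
  have w2 := h.high.withinHops_street hδ hP (s := s.perp a) (le_refl J) hp
    (v := Sum.inr (hub J)) (h.relay _ hJK) (s.crossing_mem_perp a) (by
      have : hub J = (s.perp a).crossing a := by
        unfold Street.crossing hub Street.perp
        cases s.vertical <;> rfl
      rw [this]
      exact Street.crossing_mem _ _)
  exact (w1.trans w2).mono (by omega)

theorem withinHops_hub_of_middle (h : GoodConfig ω A J H K m) (hδ : 0 ≤ δ) (hP : 0 ≤ Pmax)
    (hJK : J + J ≤ K) {s : Street} (hAs : A ≤ s.level) (hs : s.level ≤ J) {u : Node n}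
    (hu : Present ω u) (hus : position ω u ∈ s.carrier) :
    WithinHops (hopGraph δ Pmax ω Pmax) (3 * (m + 1)) u (Sum.inr (hub J)) := by
  obtain ⟨a, ha, w⟩ := h.middle.withinHops_crossing hδ hP hAs
    (fun j => h.present (s := s) (a := ⟨J, j⟩) (by change s.level + J ≤ K; omega)) hu hus
  refine (w.trans (h.withinHops_hub_of_level_eq hδ hP hJK (s := s.perp a) ha
    (h.present (by omega)) (s.crossing_mem_perp a))).mono (by omega)

theorem withinHops_hub (h : GoodConfig ω A J H K m) (hδ : 0 ≤ δ) (hP : 0 ≤ Pmax)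
    (hAJ : A ≤ J) (hJH : J ≤ H) (hJK : J + J ≤ K) (hAH : A + H ≤ K) {s : Street}
    (hs : s.level ≤ J) {u : Node n} (hu : Present ω u) (hus : position ω u ∈ s.carrier) :
    WithinHops (hopGraph δ Pmax ω Pmax) (5 * (m + 1)) u (Sum.inr (hub J)) := by
  rcases le_total A s.level with hA | hA
  · exact (h.withinHops_hub_of_middle hδ hP hJK hA hs hu hus).mono (by omega)
  · obtain ⟨a, ha, w⟩ := h.low.withinHops_crossing hδ hP (Nat.zero_le _)
      (fun j => h.present (s := s) (a := ⟨H, j⟩) (by change s.level + H ≤ K; omega)) hu hus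
    -- The street of level `H ≥ J` is sparse over its whole length, so it can be followed to an
    -- arbitrary line of level `A`.
    set b : Line := ⟨A, ⟨0, by positivity⟩⟩ with hb
    have hlev : (s.perp a).level = H := ha
    have hp : Present ω (Sum.inr ((s.perp a).crossing b)) :=
      h.present (by rw [hlev]; change H + A ≤ K; omega)
    have w2 := h.high.withinHops_street hδ hP (s := s.perp a) (by omega)
      (h.present (s := s) (a := a) (by omega)) hp (s.crossing_mem_perp a)
      (Street.crossing_mem _ _)
    have w3 := h.withinHops_hub_of_middle (δ := δ) hδ hP hJK (s := (s.perp a).perp b)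
      (le_refl A) hAJ hp (Street.crossing_mem_perp _ _)
    exact ((w.trans w2).trans w3).mono (by omega)

theorem withinHops_hub_of_mem_giant (h : GoodConfig ω A J H K m) (hδ : 0 ≤ δ) (hP : 0 ≤ Pmax)
    (hAJ : A ≤ J) (hJH : J ≤ H) (hJK : J + J ≤ K) (hAH : A + H ≤ K) {u : Node n}
    (hu : u ∈ giant δ Pmax ω 1 Pmax) :
    WithinHops (hopGraph δ Pmax ω Pmax) (6 * (m + 1)) u (Sum.inr (hub J)) := by
  obtain ⟨hup, v, -, hv, W, hW⟩ := hu
  rcases mem_support_or_exists_relay le_rfl h.uniq W hv hW with h0 | ⟨-, s, c, hus, hcs, hc, hcp⟩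
  · obtain ⟨s, hs, hus⟩ := mem_support.1 h0
    exact (h.withinHops_hub hδ hP hAJ hJH hJK hAH (by omega) hup hus).mono (by omega)
  · rcases le_total s.level J with hs | hs
    · exact (h.withinHops_hub hδ hP hAJ hJH hJK hAH hs hup hus).mono (by omega)
    · obtain ⟨s', hs', hcs'⟩ := mem_support.1 hc
      have w1 := h.high.withinHops_street hδ hP hs hup hcp hus hcs
      have w2 := h.withinHops_hub hδ hP hAJ hJH hJK hAH (s := s') (by omega) hcp hcs'
      exact (w1.trans w2).mono (by omega)

end GoodConfig


/-! ### The law of one mobile user -/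

/-- A street is determined by its direction and its line. -/
def Street.equivProd : Street ≃ Bool × Line where
  toFun s := (s.vertical, s.line)
  invFun x := ⟨x.1, x.2⟩
  left_inv _ := rfl
  right_inv _ := rfl

instance : Countable Street := Street.equivProd.injective.countable

theorem Street.continuous_point (s : Street) : Continuous s.point := by
  unfold Street.point
  split_ifs <;> fun_prop

theorem Street.subsingleton_inter {s s' : Street} (h : s ≠ s') :
    (s.carrier ∩ s'.carrier).Subsingleton := by
  obtain ⟨b, a⟩ := s
  obtain ⟨b', a'⟩ := s'
  rintro z ⟨⟨t, -, ht⟩, ⟨x, -, hx⟩⟩ z' ⟨⟨t', -, ht'⟩, ⟨x', -, hx'⟩⟩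
  have hab : b = b' → a.offset ≠ a'.offset := by
    rintro rfl he
    exact h (by rw [Line.offset_injective he])
  subst ht ht'
  cases b <;> cases b' <;> simp_all [Street.point]

theorem mobileLaw_apply (p : ℝ) {B : Set (ℝ × ℝ)} (hB : MeasurableSet B) :
    mobileLaw p B = ∑' s : Street, ENNReal.ofReal (p / 2 * ((1 - p) / 2) ^ s.level) *
      volume (s.point ⁻¹' B ∩ Set.Icc 0 1) := by
  unfold mobileLaw
  rw [Measure.sum_apply _ hB]
  refine tsum_congr fun s => ?_
  rw [Measure.smul_apply, smul_eq_mul, Measure.map_apply s.continuous_point.measurable hB,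
    Measure.restrict_apply (s.continuous_point.measurable hB)]

theorem mobileLaw_of_subsingleton (p : ℝ) {B : Set (ℝ × ℝ)} (hB : B.Subsingleton) :
    mobileLaw p B = 0 := by
  rw [mobileLaw_apply p hB.measurableSet]
  refine ENNReal.tsum_eq_zero.2 fun s => mul_eq_zero_of_right _ ?_
  exact ((hB.preimage s.point_injective).anti Set.inter_subset_left).measure_zero _

theorem mobileLaw_image_Icc (p : ℝ) (s : Street) {a b : ℝ} (ha : 0 ≤ a) (hb : b ≤ 1) :
    mobileLaw p (s.point '' Set.Icc a b) =
      ENNReal.ofReal (p / 2 * ((1 - p) / 2) ^ s.level) * ENNReal.ofReal (b - a) := by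
  have hm : MeasurableSet (s.point '' Set.Icc a b) :=
    (isCompact_Icc.image s.continuous_point).isClosed.measurableSet
  have hI : Set.Icc a b ⊆ Set.Icc (0 : ℝ) 1 := Set.Icc_subset_Icc ha hb
  rw [mobileLaw_apply p hm, tsum_eq_single s]
  · rw [s.point_injective.preimage_image, Set.inter_eq_left.2 hI, Real.volume_Icc]
  · intro s' hs'
    refine mul_eq_zero_of_right _ (Set.Subsingleton.measure_zero ?_ _)
    intro t ht t' ht'
    exact s'.point_injective (Street.subsingleton_inter hs'
      ⟨s'.point_mem_carrier.2 ht.2, Set.image_mono hI ht.1⟩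
      ⟨s'.point_mem_carrier.2 ht'.2, Set.image_mono hI ht'.1⟩)

theorem tsum_street_weight {p : ℝ} (hp0 : 0 < p) (hp1 : p < 1) :
    ∑' s : Street, ENNReal.ofReal (p / 2 * ((1 - p) / 2) ^ s.level) = 1 := by
  have hq : 0 ≤ 1 - p := by linarith
  have h1 : ∀ l : ℕ, ∑' _ : Fin (2 ^ l), ENNReal.ofReal (p / 2 * ((1 - p) / 2) ^ l) =
      ENNReal.ofReal (p / 2 * (1 - p) ^ l) := by
    intro l
    rw [tsum_fintype, Finset.sum_const, Finset.card_univ, Fintype.card_fin, nsmul_eq_mul,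
      ← ENNReal.ofReal_natCast, ← ENNReal.ofReal_mul (by positivity)]
    congr 1
    rw [div_pow]
    push_cast
    field_simp
  have h2 : ∑' a : Line, ENNReal.ofReal (p / 2 * ((1 - p) / 2) ^ a.1) = ENNReal.ofReal (1 / 2) := by
    rw [ENNReal.tsum_sigma']
    simp_rw [h1]
    have hs : HasSum (fun l : ℕ => p / 2 * (1 - p) ^ l) (1 / 2) := by
      have := (hasSum_geometric_of_lt_one hq (by linarith)).mul_left (p / 2)
      rwa [sub_sub_cancel, div_mul_eq_mul_div, mul_inv_cancel₀ hp0.ne'] at this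
    rw [← ENNReal.ofReal_tsum_of_nonneg (fun l => by positivity) hs.summable, hs.tsum_eq]
  rw [← Street.equivProd.symm.tsum_eq, ENNReal.tsum_prod']
  change ∑' _ : Bool, ∑' a : Line, ENNReal.ofReal (p / 2 * ((1 - p) / 2) ^ a.1) = 1
  rw [h2, tsum_bool, ← ENNReal.ofReal_add (by norm_num) (by norm_num)]
  norm_num

theorem isProbabilityMeasure_mobileLaw {p : ℝ} (hp0 : 0 < p) (hp1 : p < 1) :
    IsProbabilityMeasure (mobileLaw p) := by
  constructor
  rw [mobileLaw_apply p MeasurableSet.univ, ← tsum_street_weight hp0 hp1]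
  simp

/-! ### Probabilities of the exceptional events -/

/-- Union bound over the `m`-subsets of users that all fall in `B`. -/
theorem pi_ncard_ge_le {α : Type*} [MeasurableSpace α] (μ : Measure α) [IsProbabilityMeasure μ]
    (B : Set α) (n m : ℕ) :
    Measure.pi (fun _ : Fin n => μ) {f | m ≤ {i | f i ∈ B}.ncard} ≤ n.choose m * μ B ^ m := by
  classical
  have hsub : {f : Fin n → α | m ≤ {i | f i ∈ B}.ncard} ⊆
      ⋃ S ∈ Finset.powersetCard m (Finset.univ : Finset (Fin n)),
        Set.univ.pi fun i => if i ∈ S then B else Set.univ := by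
    intro f hf
    obtain ⟨t, ht, hcard⟩ := Set.exists_subset_card_eq hf
    refine Set.mem_biUnion (x := t.toFinset) ?_ ?_
    · exact Finset.mem_powersetCard.2 ⟨Finset.subset_univ _, by rwa [← Set.ncard_eq_toFinset_card']⟩
    · intro i _
      by_cases hi : i ∈ t
      · simpa [hi] using ht hi
      · simp [hi]
  refine (measure_mono hsub).trans ((measure_biUnion_finset_le _ _).trans ?_)
  refine (Finset.sum_le_sum (g := fun _ => μ B ^ m) fun S hS => ?_).trans ?_
  · rw [Measure.pi_pi]
    rw [Finset.mem_powersetCard] at hS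
    have : ∀ i, μ (if i ∈ S then B else Set.univ) = if i ∈ S then μ B else 1 := by
      intro i; split_ifs <;> simp
    simp_rw [this]
    rw [Finset.prod_ite_mem, Finset.univ_inter, Finset.prod_const, hS.2]
  · simp [Finset.card_powersetCard]

variable {p pr : ℝ}

/-- An inequality suffices for upper bounds and spares any measurability of `E`. -/
theorem mapLaw_preimage_fst_le (hp0 : 0 < p) (hp1 : p < 1) (n : ℕ) (E : Set (Fin n → ℝ × ℝ)) :
    mapLaw p pr n {ω | ω.1 ∈ E} ≤ Measure.pi (fun _ : Fin n => mobileLaw p) E := by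
  have := isProbabilityMeasure_mobileLaw hp0 hp1
  have hmap : (mapLaw p pr n).map Prod.fst = Measure.pi fun _ : Fin n => mobileLaw p := by
    unfold mapLaw
    exact measurePreserving_fst.map_eq
  exact (Measure.le_map_apply measurable_fst.aemeasurable E).trans_eq (by rw [hmap])

/-- There are infinitely many streets, so a uniform bound per interval cannot be summed. Of the `m +
1` factors of mass, `m` are bounded by `x` and one is kept; the kept masses sum to at most one over
all intervals. -/
theorem mapLaw_not_sparseUsers_le (hp0 : 0 < p) (hp1 : p < 1) (n l k m : ℕ) {x : ℝ}
    (hx : ((1 - p) / 2) ^ l / 2 ^ k ≤ x) :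
    mapLaw p pr n {ω | ¬ SparseUsers ω l k m} ≤
      ENNReal.ofReal (n.choose (m + 1) * x ^ m) := by
  have := isProbabilityMeasure_mobileLaw hp0 hp1
  have hu0 : 0 ≤ (1 - p) / 2 := by linarith
  have hu1 : (1 - p) / 2 ≤ 1 := by linarith
  have hx0 : 0 ≤ x := le_trans (by positivity) hx
  set c : ENNReal := ENNReal.ofReal (n.choose (m + 1) * x ^ m) with hc
  have hsub : {ω : Config n | ¬ SparseUsers ω l k m} ⊆ ⋃ y : Street × Fin (2 ^ k),
      {ω | ω.1 ∈ {f : Fin n → ℝ × ℝ | l ≤ y.1.level ∧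
        m + 1 ≤ {i | f i ∈ y.1.point '' dyadic k y.2}.ncard}} := by
    intro ω hω
    simp only [SparseUsers, Set.mem_ofPred_eq, not_forall, not_le] at hω
    obtain ⟨s, hs, j, hj, h⟩ := hω
    exact Set.mem_iUnion.2 ⟨(s, ⟨j, hj⟩), hs, h⟩
  have hterm : ∀ y : Street × Fin (2 ^ k),
      mapLaw p pr n {ω | ω.1 ∈ {f : Fin n → ℝ × ℝ | l ≤ y.1.level ∧
        m + 1 ≤ {i | f i ∈ y.1.point '' dyadic k y.2}.ncard}} ≤
      ENNReal.ofReal (p / 2 * ((1 - p) / 2) ^ y.1.level) * ENNReal.ofReal (1 / 2 ^ k) * c := by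
    rintro ⟨s, j⟩
    refine (mapLaw_preimage_fst_le hp0 hp1 n _).trans ?_
    by_cases hs : l ≤ s.level
    swap
    · simp [hs]
    simp only [hs, true_and]
    refine (pi_ncard_ge_le (mobileLaw p) _ n (m + 1)).trans ?_
    have hj : ((j : ℕ) : ℝ) + 1 ≤ 2 ^ k := by exact_mod_cast j.2
    rw [dyadic, mobileLaw_image_Icc p s (by positivity) (by rwa [div_le_one (by positivity)]),
      ← sub_div, add_sub_cancel_left, pow_succ, ← mul_assoc, mul_comm]
    gcongr
    rw [hc, ENNReal.ofReal_mul (p := (n.choose (m + 1) : ℝ)) (by positivity),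
      ENNReal.ofReal_natCast, ENNReal.ofReal_pow hx0]
    gcongr
    rw [← ENNReal.ofReal_mul (by positivity)]
    refine ENNReal.ofReal_le_ofReal (le_trans ?_ hx)
    rw [mul_one_div]
    gcongr
    calc p / 2 * ((1 - p) / 2) ^ s.level ≤ 1 * ((1 - p) / 2) ^ s.level := by gcongr; linarith
      _ ≤ ((1 - p) / 2) ^ l := by rw [one_mul]; exact pow_le_pow_of_le_one hu0 hu1 hs
  refine (measure_mono hsub).trans ((measure_iUnion_le _).trans
    ((ENNReal.tsum_le_tsum hterm).trans_eq ?_))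
  rw [ENNReal.tsum_mul_right, ENNReal.tsum_prod']
  have h2 : ∀ s : Street, ∑' _ : Fin (2 ^ k), ENNReal.ofReal (p / 2 * ((1 - p) / 2) ^ s.level) *
      ENNReal.ofReal (1 / 2 ^ k) = ENNReal.ofReal (p / 2 * ((1 - p) / 2) ^ s.level) := by
    intro s
    rw [tsum_fintype, Finset.sum_const, Finset.card_univ, Fintype.card_fin, nsmul_eq_mul,
      mul_left_comm, ← ENNReal.ofReal_natCast, ← ENNReal.ofReal_mul (by positivity)]
    push_cast
    rw [mul_one_div_cancel (by positivity), ENNReal.ofReal_one, mul_one]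
  simp_rw [h2]
  rw [tsum_street_weight hp0 hp1, one_mul]

/-- Distinct streets meet in at most one point, which has mass zero, and there are countably many
pairs. -/
theorem mapLaw_not_unique_street (hp0 : 0 < p) (hp1 : p < 1) (n : ℕ) :
    mapLaw p pr n {ω | ¬ ∀ i s s', ω.1 i ∈ Street.carrier s → ω.1 i ∈ Street.carrier s' → s = s'} =
      0 := by
  have := isProbabilityMeasure_mobileLaw hp0 hp1
  have hsub : {ω : Config n | ¬ ∀ i s s', ω.1 i ∈ Street.carrier s →
      ω.1 i ∈ Street.carrier s' → s = s'} ⊆ ⋃ (y : Fin n × Street × Street) (_ : y.2.1 ≠ y.2.2),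
      {ω | ω.1 ∈ Function.eval y.1 ⁻¹' (y.2.1.carrier ∩ y.2.2.carrier)} := by
    intro ω hω
    simp only [Set.mem_ofPred_eq, not_forall] at hω
    obtain ⟨i, s, s', h, h', hne⟩ := hω
    exact Set.mem_iUnion₂.2 ⟨(i, s, s'), hne, h, h'⟩
  refine measure_mono_null hsub (measure_iUnion_null fun y => measure_iUnion_null fun hy => ?_)
  refine le_antisymm ((mapLaw_preimage_fst_le hp0 hp1 n _).trans_eq ?_) zero_le
  exact Measure.pi_eval_preimage_null _ (mobileLaw_of_subsingleton p (Street.subsingleton_inter hy))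

theorem mapLaw_no_relay_le (hp0 : 0 < p) (hp1 : p < 1) (n : ℕ) (c : Crossing) :
    mapLaw p pr n {ω | ω.2 c = 0} ≤
      ENNReal.ofReal (Real.exp (-(n * pr ^ 2 * ((1 - pr) / 2) ^ (c.1.1 + c.2.1)))) := by
  have := isProbabilityMeasure_mobileLaw hp0 hp1
  set ν := Measure.infinitePi fun c : Crossing =>
      ProbabilityTheory.poissonMeasure (relayIntensity n pr c)
  have h1 : mapLaw p pr n {ω | ω.2 c = 0} ≤ ν {f | f c = 0} := by
    have hmap : (mapLaw p pr n).map Prod.snd = ν := by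
      unfold mapLaw
      exact measurePreserving_snd.map_eq
    exact (Measure.le_map_apply measurable_snd.aemeasurable {f : Crossing → ℕ | f c = 0}).trans_eq
      (by rw [hmap])
  have h2 : ν {f | f c = 0} = ProbabilityTheory.poissonMeasure (relayIntensity n pr c) {0} :=
    (measurePreserving_eval_infinitePi (fun c : Crossing =>
      ProbabilityTheory.poissonMeasure (relayIntensity n pr c)) c).measure_preimage
      (measurableSet_singleton 0).nullMeasurableSet
  refine h1.trans (h2.le.trans ?_)
  rw [ProbabilityTheory.poissonMeasure_singleton]
  refine ENNReal.ofReal_le_ofReal ?_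
  simp only [pow_zero, mul_one, Nat.factorial_zero, Nat.cast_one, div_one]
  exact Real.exp_le_exp.2 (neg_le_neg (Real.le_coe_toNNReal _))

theorem mapLaw_missing_relay_le (hp0 : 0 < p) (hp1 : p < 1) (hpr0 : 0 < pr) (hpr1 : pr < 1)
    (n K : ℕ) :
    mapLaw p pr n {ω | ¬ ∀ c : Crossing, c.1.1 + c.2.1 ≤ K → ω.2 c ≠ 0} ≤
      ENNReal.ofReal (4 ^ (K + 1) * Real.exp (-(n * pr ^ 2 * ((1 - pr) / 2) ^ K))) := by
  set F : Finset Line := (Finset.range (K + 1)).sigma fun _ => Finset.univ with hF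
  have hcard : F.card ≤ 2 ^ (K + 1) := by
    rw [hF, Finset.card_sigma]
    simp only [Finset.card_univ, Fintype.card_fin]
    exact (Nat.geomSum_lt le_rfl (by simp)).le
  have hsub : {ω : Config n | ¬ ∀ c : Crossing, c.1.1 + c.2.1 ≤ K → ω.2 c ≠ 0} ⊆
      ⋃ c ∈ (F ×ˢ F).filter (fun c : Crossing => c.1.1 + c.2.1 ≤ K), {ω | ω.2 c = 0} := by
    intro ω hω
    simp only [Set.mem_ofPred_eq, not_forall, not_not] at hω
    obtain ⟨c, hc, h⟩ := hω
    refine Set.mem_biUnion (x := c) ?_ h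
    simp only [hF, Finset.coe_filter, Finset.mem_product, Finset.mem_sigma, Finset.mem_range,
      Finset.mem_univ, Set.mem_ofPred_eq]
    exact ⟨⟨⟨by omega, trivial⟩, by omega, trivial⟩, hc⟩
  refine (measure_mono hsub).trans ((measure_biUnion_finset_le _ _).trans ?_)
  refine (Finset.sum_le_sum (g := fun _ => ENNReal.ofReal
    (Real.exp (-(n * pr ^ 2 * ((1 - pr) / 2) ^ K)))) fun c hc => ?_).trans ?_
  · refine (mapLaw_no_relay_le hp0 hp1 n c).trans (ENNReal.ofReal_le_ofReal (Real.exp_le_exp.2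
      (neg_le_neg ?_)))
    exact mul_le_mul_of_nonneg_left (pow_le_pow_of_le_one (by linarith) (by linarith)
      (Finset.mem_filter.1 hc).2) (by positivity)
  · rw [Finset.sum_const, nsmul_eq_mul, ENNReal.ofReal_mul (by positivity)]
    gcongr
    rw [← ENNReal.ofReal_natCast]
    refine ENNReal.ofReal_le_ofReal ?_
    have h1 : ((F ×ˢ F).filter (fun c : Crossing => c.1.1 + c.2.1 ≤ K)).card ≤ 4 ^ (K + 1) := by
      refine (Finset.card_filter_le _ _).trans ?_
      rw [Finset.card_product, show 4 = 2 * 2 from rfl, mul_pow]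
      exact Nat.mul_le_mul hcard hcard
    exact_mod_cast h1

theorem mapLaw_not_goodConfig_le (hp0 : 0 < p) (hp1 : p < 1) (hpr0 : 0 < pr) (hpr1 : pr < 1)
    {n A J H K m : ℕ} {x : ℝ} (hJ : ((1 - p) / 2) ^ J ≤ x) (hH : 1 / 2 ^ H ≤ x)
    (hA : ((1 - p) / 2) ^ A / 2 ^ J ≤ x) :
    mapLaw p pr n {ω | ¬ GoodConfig ω A J H K m} ≤
      ENNReal.ofReal (4 ^ (K + 1) * Real.exp (-(n * pr ^ 2 * ((1 - pr) / 2) ^ K))) +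
        3 * ENNReal.ofReal (n.choose (m + 1) * x ^ m) := by
  have hsub : {ω : Config n | ¬ GoodConfig ω A J H K m} ⊆
      {ω | ¬ ∀ i s s', ω.1 i ∈ Street.carrier s → ω.1 i ∈ Street.carrier s' → s = s'} ∪
      ({ω | ¬ ∀ c : Crossing, c.1.1 + c.2.1 ≤ K → ω.2 c ≠ 0} ∪
      ({ω | ¬ SparseUsers ω J 0 m} ∪ ({ω | ¬ SparseUsers ω A J m} ∪
        {ω | ¬ SparseUsers ω 0 H m}))) := by
    intro ω hω
    by_contra hcon
    simp only [Set.mem_union, Set.mem_ofPred_eq, not_or, not_not] at hcon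
    exact hω ⟨hcon.1, hcon.2.1, hcon.2.2.1, hcon.2.2.2.1, hcon.2.2.2.2⟩
  have h1 := mapLaw_not_sparseUsers_le (pr := pr) hp0 hp1 n J 0 m (x := x) (by simpa using hJ)
  have h2 := mapLaw_not_sparseUsers_le (pr := pr) hp0 hp1 n A J m hA
  have h3 := mapLaw_not_sparseUsers_le (pr := pr) hp0 hp1 n 0 H m (x := x) (by simpa using hH)
  refine (measure_mono hsub).trans ((measure_union_le _ _).trans ?_)
  rw [mapLaw_not_unique_street hp0 hp1, zero_add]
  refine (measure_union_le _ _).trans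
    (add_le_add (mapLaw_missing_relay_le hp0 hp1 hpr0 hpr1 n K) ?_)
  refine (measure_union_le _ _).trans
    ((add_le_add h1 ((measure_union_le _ _).trans (add_le_add h2 h3))).trans_eq ?_)
  ring


/-! ### Choice of the levels and asymptotics -/

theorem half_one_sub_eq_rpow (hp1 : p < 1) : (1 - p) / 2 = 2 ^ (1 - dimF p) := by
  have hq : 0 < 1 - p := by linarith
  have hl : Real.log 2 ≠ 0 := (Real.log_pos one_lt_two).ne'
  rw [Real.rpow_def_of_pos two_pos, mul_sub, mul_one, dimF, mul_div_cancel₀ _ hl,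
    Real.exp_sub, Real.exp_log two_pos, Real.exp_log (by positivity)]
  field_simp
  norm_num

theorem half_one_sub_eq_rpow_dimR (hpr1 : pr < 1) : (1 - pr) / 2 = 2 ^ (-(dimR pr / 2)) := by
  have hq : 0 < 1 - pr := by linarith
  have hl : Real.log 2 ≠ 0 := (Real.log_pos one_lt_two).ne'
  rw [Real.rpow_def_of_pos two_pos, dimR, mul_div_cancel_left₀ _ (two_ne_zero), mul_neg,
    mul_div_cancel₀ _ hl, Real.exp_neg, Real.exp_log (by positivity), inv_div]

theorem two_lt_dimR (hpr0 : 0 < pr) (hpr1 : pr < 1) : 2 < dimR pr := by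
  have hl : 0 < Real.log 2 := Real.log_pos one_lt_two
  have : 1 < Real.log (2 / (1 - pr)) / Real.log 2 := by
    rw [one_lt_div hl]
    refine Real.log_lt_log two_pos ?_
    rw [lt_div_iff₀ (by linarith)]
    linarith
  unfold dimR
  linarith

/-- The constant 9 comes from `e^2 ≤ 9`: dividing `(9T)^m / m! ≤ e^(9T)` by `9^m ≥ e^(2m) ≥ e^(18T)`
leaves `e^(-9T)`. -/
theorem pow_div_factorial_le_exp_neg {T : ℝ} (hT : 0 ≤ T) {m : ℕ} (hm : 9 * T ≤ m) :
    T ^ m / m.factorial ≤ Real.exp (-(9 * T)) := by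
  have h1 : (9 * T) ^ m / m.factorial ≤ Real.exp (9 * T) :=
    Real.pow_div_factorial_le_exp _ (by positivity) m
  have h2 : Real.exp (18 * T) ≤ 9 ^ m := by
    have he : Real.exp 2 ≤ 9 := by
      have h3 := Real.exp_one_lt_d9
      have : Real.exp 2 = Real.exp 1 * Real.exp 1 := by rw [← Real.exp_add]; norm_num
      rw [this]
      nlinarith [Real.exp_pos 1]
    calc Real.exp (18 * T) ≤ Real.exp (m * 2) := Real.exp_le_exp.2 (by linarith)
      _ = Real.exp 2 ^ m := Real.exp_nat_mul 2 m
      _ ≤ 9 ^ m := by gcongr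
  have h3 : T ^ m / m.factorial = (9 * T) ^ m / m.factorial / 9 ^ m := by
    rw [mul_pow]
    field_simp
  rw [h3, div_le_iff₀ (by positivity)]
  calc (9 * T) ^ m / m.factorial ≤ Real.exp (9 * T) := h1
    _ = Real.exp (-(9 * T)) * Real.exp (18 * T) := by rw [← Real.exp_add]; ring_nf
    _ ≤ _ := by gcongr

theorem choose_mul_pow_le {n m : ℕ} {x : ℝ} (hx : 0 ≤ x) (hm : 9 * (n * x) ≤ m) :
    (n.choose (m + 1) : ℝ) * x ^ m ≤ n * Real.exp (-(9 * (n * x))) := by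
  have h1 : (n.choose (m + 1) : ℝ) ≤ n ^ (m + 1) / (m + 1).factorial :=
    Nat.choose_le_pow_div (m + 1) n
  have h2 : (n : ℝ) ^ (m + 1) / (m + 1).factorial ≤ n ^ (m + 1) / m.factorial := by
    gcongr
    exact Nat.le_succ m
  calc (n.choose (m + 1) : ℝ) * x ^ m ≤ n ^ (m + 1) / m.factorial * x ^ m := by
        gcongr
        exact h1.trans h2
    _ = n * ((n * x) ^ m / m.factorial) := by rw [mul_pow]; ring
    _ ≤ _ := by
        gcongr
        exact pow_div_factorial_le_exp_neg (by positivity) hm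

theorem tendsto_rpow_mul_exp_neg_mul_rpow (s : ℝ) {b γ : ℝ} (hb : 0 < b) (hγ : 0 < γ) :
    Tendsto (fun n : ℕ => (n : ℝ) ^ s * Real.exp (-(b * (n : ℝ) ^ γ))) atTop (𝓝 0) := by
  have h := (tendsto_rpow_mul_exp_neg_mul_atTop_nhds_zero (s / γ) b hb).comp
    ((tendsto_rpow_atTop hγ).comp tendsto_natCast_atTop_atTop)
  refine h.congr fun n => ?_
  simp only [Function.comp_apply]
  rw [← Real.rpow_mul (Nat.cast_nonneg n), mul_div_cancel₀ _ hγ.ne', neg_mul]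

/-- The level sums of the crossings used for routing stay below the critical one by a fixed
factor. -/
theorem ladder_lt {D : ℝ} (hD : 3 < D) :
    max (1 + (D - 2) / (D - 1) ^ 2) (2 / (D - 1)) < 1 + 1 / D := by
  refine max_lt ?_ ?_
  · refine add_lt_add_of_le_of_lt le_rfl ?_
    rw [div_lt_div_iff₀ (by nlinarith) (by linarith)]
    nlinarith
  · have h1 : 2 / (D - 1) < 1 := by rw [div_lt_one (by linarith)]; linarith
    have h2 : 0 < 1 / D := by positivity
    linarith

theorem exists_levels (hp0 : 0 < p) (hp1 : p < 1) (hpr0 : 0 < pr) (hpr1 : pr < 1)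
    (hF : 3 < dimF p) {a θ : ℝ} (ha : 0 ≤ a)
    (hθ : θ = a * max (1 + (dimF p - 2) / (dimF p - 1) ^ 2) (2 / (dimF p - 1)))
    {n : ℕ} (hn : 1 ≤ n) :
    ∃ A J H K : ℕ, A ≤ J ∧ J ≤ H ∧ J + J ≤ K ∧ A + H ≤ K ∧
      mapLaw p pr n {ω | ¬ GoodConfig ω A J H K ⌈9 * (n : ℝ) ^ (1 - a)⌉₊} ≤
        ENNReal.ofReal (64 * ((n : ℝ) ^ (2 * θ) * Real.exp
          (-(pr ^ 2 * 2 ^ (-dimR pr) * (n : ℝ) ^ (1 - dimR pr / 2 * θ))))) +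
        3 * ENNReal.ofReal ((n : ℝ) ^ (1 : ℝ) * Real.exp (-(9 * (n : ℝ) ^ (1 - a)))) := by
  set D := dimF p with hD
  set R := dimR pr with hR
  have hR2 : 2 < R := two_lt_dimR hpr0 hpr1
  have hn0 : (0 : ℝ) < n := by exact_mod_cast hn
  set l : ℝ := Real.logb 2 n with hl
  have hl0 : 0 ≤ l := Real.logb_nonneg one_lt_two (by exact_mod_cast hn)
  have hnl : (2 : ℝ) ^ l = n := Real.rpow_logb two_pos (by norm_num) hn0
  have hpow : ∀ y : ℝ, (n : ℝ) ^ y = 2 ^ (l * y) := fun y => by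
    rw [Real.rpow_mul two_pos.le, hnl]
  have hD1 : 0 < D - 1 := by linarith
  set x : ℝ := (n : ℝ) ^ (-a) with hx
  have hx2 : x = 2 ^ (-(a * l)) := by rw [hx, hpow]; ring_nf
  have hu : ∀ k : ℕ, ((1 - p) / 2) ^ k = 2 ^ ((1 - D) * k) := fun k => by
    rw [half_one_sub_eq_rpow hp1, Real.rpow_mul_natCast two_pos.le]
  have hr : ∀ k : ℕ, ((1 - pr) / 2) ^ k = 2 ^ (-(R / 2) * k) := fun k => by
    rw [half_one_sub_eq_rpow_dimR hpr1, Real.rpow_mul_natCast two_pos.le]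
  have hal : 0 ≤ a * l := by positivity
  have hD2 : (0 : ℝ) ≤ D - 2 := by linarith
  -- The exact values solve `(D-1) J = a l`, `H = a l` and `(D-1) A + J = a l`, the conditions for
  -- mass at most `x = 2^(-a l)`; rounding up only shrinks the masses.
  set A := ⌈a * l * ((D - 2) / (D - 1) ^ 2)⌉₊ with hA
  set J := ⌈a * l / (D - 1)⌉₊ with hJ
  set H := ⌈a * l⌉₊ with hH
  -- The 2 absorbs the two ceilings in `J + J` and in `A + H`. It costs the factor `2^(-R)` in the
  -- relay exponent, and with `K + 1 ≤ θ l + 3` gives `4^3 = 64` below.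
  set K := ⌊θ * l + 2⌋₊ with hK
  have hA1 : a * l * ((D - 2) / (D - 1) ^ 2) ≤ A := Nat.le_ceil _
  have hA2 : (A : ℝ) < a * l * ((D - 2) / (D - 1) ^ 2) + 1 := Nat.ceil_lt_add_one (by positivity)
  have hJ1 : a * l / (D - 1) ≤ J := Nat.le_ceil _
  have hJ2 : (J : ℝ) < a * l / (D - 1) + 1 := Nat.ceil_lt_add_one (by positivity)
  have hH1 : a * l ≤ H := Nat.le_ceil _
  have hH2 : (H : ℝ) < a * l + 1 := Nat.ceil_lt_add_one (by positivity)
  have hθ1 : a * l * (1 + (D - 2) / (D - 1) ^ 2) ≤ θ * l := by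
    rw [hθ, mul_right_comm a _ l]
    exact mul_le_mul_of_nonneg_left (le_max_left _ _) hal
  have hθ2 : a * l * (2 / (D - 1)) ≤ θ * l := by
    rw [hθ, mul_right_comm a _ l]
    exact mul_le_mul_of_nonneg_left (le_max_right _ _) hal
  have hθ0 : 0 ≤ θ * l := le_trans (by positivity) hθ2
  have hK2 : (K : ℝ) ≤ θ * l + 2 := Nat.floor_le (by linarith)
  have hJl : a * l ≤ (D - 1) * J := by rwa [div_le_iff₀' hD1] at hJ1
  refine ⟨A, J, H, K, Nat.ceil_mono ?_, Nat.ceil_mono ?_, ?_, ?_, ?_⟩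
  · rw [div_eq_mul_inv (a * l)]
    gcongr
    rw [div_le_iff₀ (by positivity), pow_two, inv_mul_cancel_left₀ hD1.ne']
    linarith
  · exact div_le_self hal (by linarith)
  · refine Nat.le_floor ?_
    push_cast
    have : a * l / (D - 1) + a * l / (D - 1) = a * l * (2 / (D - 1)) := by ring
    linarith
  · refine Nat.le_floor ?_
    push_cast
    linarith
  have hnx : (n : ℝ) * x = (n : ℝ) ^ (1 - a) := by
    rw [hx, sub_eq_add_neg, Real.rpow_add hn0, Real.rpow_one]
  refine (mapLaw_not_goodConfig_le hp0 hp1 hpr0 hpr1 (x := x) ?_ ?_ ?_).trans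
    (add_le_add (ENNReal.ofReal_le_ofReal ?_) ?_)
  · rw [hu, hx2]
    exact Real.rpow_le_rpow_of_exponent_le one_le_two (by linarith)
  · rw [one_div, ← Real.rpow_natCast, ← Real.rpow_neg two_pos.le, hx2]
    exact Real.rpow_le_rpow_of_exponent_le one_le_two (by linarith)
  · rw [hu, ← Real.rpow_natCast, ← Real.rpow_sub two_pos, hx2]
    refine Real.rpow_le_rpow_of_exponent_le one_le_two ?_
    have h1 := mul_le_mul_of_nonneg_left hA1 hD1.le
    have h2 : (D - 1) * (a * l * ((D - 2) / (D - 1) ^ 2)) + a * l / (D - 1) = a * l := by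
      field_simp
      ring
    linarith
  · have h4 : (4 : ℝ) ^ (K + 1) ≤ 64 * (n : ℝ) ^ (2 * θ) := by
      have : (64 : ℝ) = 2 ^ (6 : ℝ) := by norm_num
      rw [show (4 : ℝ) = 2 ^ (2 : ℝ) by norm_num, ← Real.rpow_mul_natCast two_pos.le, hpow, this,
        ← Real.rpow_add two_pos]
      refine Real.rpow_le_rpow_of_exponent_le one_le_two ?_
      push_cast
      linarith
    have h5 : pr ^ 2 * 2 ^ (-R) * (n : ℝ) ^ (1 - R / 2 * θ) ≤
        n * pr ^ 2 * ((1 - pr) / 2) ^ K := by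
      have : (2 : ℝ) ^ (-R) * (n : ℝ) ^ (1 - R / 2 * θ) ≤ n * ((1 - pr) / 2) ^ K := by
        rw [hr, hpow, ← Real.rpow_add two_pos]
        nth_rw 1 [← hnl]
        rw [← Real.rpow_add two_pos]
        refine Real.rpow_le_rpow_of_exponent_le one_le_two ?_
        nlinarith
      calc _ = pr ^ 2 * ((2 : ℝ) ^ (-R) * (n : ℝ) ^ (1 - R / 2 * θ)) := by ring
        _ ≤ pr ^ 2 * (n * ((1 - pr) / 2) ^ K) := by gcongr
        _ = _ := by ring
    rw [← mul_assoc]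
    gcongr
  · refine mul_le_mul' le_rfl (ENNReal.ofReal_le_ofReal ?_)
    rw [← hnx, Real.rpow_one]
    exact choose_mul_pow_le (by positivity) (Nat.le_ceil _)

end Hyperfractal

theorem mainTheorem5 (p pr : ℝ) (hp0 : 0 < p) (hp1 : p < 1) (hpr0 : 0 < pr) (hpr1 : pr < 1)
    (hF : 3 < Hyperfractal.dimF p) (hr : Hyperfractal.dimR pr < Hyperfractal.dimF p - 1) :
    ∃ C : ℝ, 0 < C ∧ ∀ δ Pmax : ℝ, 2 ≤ δ → 0 < Pmax →
      Tendsto (fun n : ℕ => Hyperfractal.mapLaw p pr n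
        {ω | ¬ ∀ u ∈ Hyperfractal.giant δ Pmax ω 1 Pmax,
          ∀ v ∈ Hyperfractal.giant δ Pmax ω 1 Pmax,
            (Hyperfractal.hopGraph δ Pmax ω Pmax).Reachable u v ∧
              ((Hyperfractal.hopGraph δ Pmax ω Pmax).dist u v : ℝ) ≤
                C * (n : ℝ) ^ (1 - 2 / (Hyperfractal.dimR pr *
                  (1 + 1 / Hyperfractal.dimF p)))})
        atTop (𝓝 0) := by
  have hF0 : 0 < Hyperfractal.dimF p := by linarith
  have hR := Hyperfractal.two_lt_dimR hpr0 hpr1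
  set D := Hyperfractal.dimF p with hD
  set R := Hyperfractal.dimR pr with hRdef
  set a : ℝ := 2 / (R * (1 + 1 / D)) with ha
  have hden : 2 < R * (1 + 1 / D) := by
    have : 0 < R * (1 / D) := by positivity
    linarith
  have ha0 : 0 < a := by positivity
  have ha1 : a < 1 := by rw [ha, div_lt_one (by linarith)]; exact hden
  set θ : ℝ := a * max (1 + (D - 2) / (D - 1) ^ 2) (2 / (D - 1)) with hθ
  -- The exponent `a` is defined so that `a (1 + 1/D)` is the critical level sum `2/R`; the strict
  -- gap in `ladder_lt` leaves a positive power of `n` in the relay exponent.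
  have hθ1 : 0 < 1 - R / 2 * θ := by
    have h1 : θ < a * (1 + 1 / D) := mul_lt_mul_of_pos_left (Hyperfractal.ladder_lt hF) ha0
    have h2 : R / 2 * (a * (1 + 1 / D)) = 1 := by
      rw [ha]
      field_simp
    have h3 := mul_lt_mul_of_pos_left h1 (show 0 < R / 2 by linarith)
    linarith
  -- With `T = n^(1-a) ≥ 1` and `m = ⌈9T⌉ < 9T + 1`, the two routes to the hub take at most `12 (m +
  -- 1) ≤ 108 T + 24 ≤ 132 T` hops.
  refine ⟨132, by norm_num, fun δ Pmax hδ hP => ?_⟩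
  have hlim1 := (Hyperfractal.tendsto_rpow_mul_exp_neg_mul_rpow (2 * θ)
    (b := pr ^ 2 * 2 ^ (-R)) (by positivity) hθ1).const_mul 64
  have hlim2 := Hyperfractal.tendsto_rpow_mul_exp_neg_mul_rpow 1 (b := 9) (by norm_num)
    (show 0 < 1 - a by linarith)
  have hlim := (ENNReal.tendsto_ofReal hlim1).add (ENNReal.Tendsto.const_mul
    (a := 3) (ENNReal.tendsto_ofReal hlim2) (Or.inr (by norm_num)))
  simp only [mul_zero, ENNReal.ofReal_zero, add_zero] at hlim
  refine tendsto_of_tendsto_of_tendsto_of_le_of_le' tendsto_const_nhds hlim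
    (Eventually.of_forall fun _ => zero_le) ?_
  filter_upwards [eventually_ge_atTop 1] with n hn
  obtain ⟨A, J, H, K, hAJ, hJH, hJK, hAH, hle⟩ :=
    Hyperfractal.exists_levels hp0 hp1 hpr0 hpr1 hF ha0.le hθ hn
  refine le_trans (measure_mono ?_) hle
  intro ω hω hgood
  refine hω fun u hu v hv => ?_
  obtain ⟨W, hW⟩ := (hgood.withinHops_hub_of_mem_giant (by linarith) hP.le hAJ hJH hJK hAH hu).trans
    (hgood.withinHops_hub_of_mem_giant (by linarith) hP.le hAJ hJH hJK hAH hv).symm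
  refine ⟨⟨W⟩, ?_⟩
  have hT : 1 ≤ (n : ℝ) ^ (1 - a) := Real.one_le_rpow (by exact_mod_cast hn) (by linarith)
  have hceil := Nat.ceil_lt_add_one (show 0 ≤ 9 * (n : ℝ) ^ (1 - a) by positivity)
  have hd := (SimpleGraph.dist_le W).trans hW
  have hd' : ((Hyperfractal.hopGraph δ Pmax ω Pmax).dist u v : ℝ) ≤
      6 * (⌈9 * (n : ℝ) ^ (1 - a)⌉₊ + 1) + 6 * (⌈9 * (n : ℝ) ^ (1 - a)⌉₊ + 1) := by
    exact_mod_cast hd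
  linarith
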